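/- Let $\mathcal H$ be a complex Hilbert space and let $\mathcal B(\mathcal H)$ be the space of bounded linear operators on it. For a bounded operator $T$ on a complex Hilbert space let $W(T)=\{\langle Tx,x\rangle : \|x\|=1\}$ be its numerical range and $w(T)=\sup\{|\mu| : \mu\in W(T)\}$ its numerical radius (with $w=0$ on the zero space). For $\alpha\in(0,\pi/2]$ let $$S(\alpha)=\{a+ib : a,b\in\mathbb R,\ |b|\cos\alpha\le a\sin\alpha\},$$ that is, $\{a+ib : |b|\le a\tan\alpha\}$ if $\alpha<\pi/2$ and the closed right half-plane if $\alpha=\pi/2$, and let $$\tau(\alpha)=\sup\{\|T\|/w(T) : T\in\mathcal B(\mathcal H),\ T\neq 0,\ W(T)\subseteq S(\alpha)\}.$$ **Theorem.** Let $\alpha\in(0,\pi/2]$ and let $T\in\mathcal B(\mathcal H)$ be nonzero with $W(T)\subseteq S(\alpha)$. (a) $\|T\|/w(T)=\tau(\alpha)$ if and only if $w(T/\|T\|)=1/\tau(\alpha)$. (b) Suppose that $T/\|T\|$ is unitarily similar to $T_1\oplus T_2$, where $T_1$ is the operator on $\mathbb C^2$ given by the matrix $$\frac{1}{1+2s}\begin{pmatrix}\sqrt{1+s-s^2}+i\sqrt{s+s^2}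 & 2s\\ 0 & \sqrt{1+s-s^2}-i\sqrt{s+s^2}\end{pmatrix},\qquad s=\sin^2\alpha,$$ and $T_2$ is a bounded operator on some (possibly zero) complex Hilbert space with $w(T_2)\le 1/\tau(\alpha)$. Then $\|T\|/w(T)=\tau(\alpha)$. -/

import Mathlib

noncomputable section

/-- The numerical range `W(T) = {⟨Tx, x⟩ : ‖x‖ = 1}`. Mathlib's inner product is linear in its
second argument, so `⟨Tx, x⟩` in the usual convention is `inner ℂ x (T x)`. -/
def numericalRange {H : Type*} [NormedAddCommGroup H] [InnerProductSpace ℂ H]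
    (T : H →L[ℂ] H) : Set ℂ :=
  {z | ∃ x : H, ‖x‖ = 1 ∧ inner ℂ x (T x) = z}

/-- The numerical radius `w(T) = sup {|z| : z ∈ W(T)}`. It is `0` on the zero space. -/
def numericalRadius {H : Type*} [NormedAddCommGroup H] [InnerProductSpace ℂ H]
    (T : H →L[ℂ] H) : ℝ :=
  sSup ((fun z : ℂ => ‖z‖) '' numericalRange T)

/-- The sector `S(α) = {a + ib : |b| ≤ a tan α}`, for `0 < α ≤ π / 2`. The inequality is multiplied
by `cos α`, so that `α = π / 2`, where `tan α = ∞`, gives the closed right half-plane. -/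
def sector (α : ℝ) : Set ℂ :=
  {z | |z.im| * Real.cos α ≤ z.re * Real.sin α}

/-- The set of ratios `‖T‖ / w(T)` for nonzero `T` with `W(T) ⊆ S(α)`. -/
def ratioSet (H : Type*) [NormedAddCommGroup H] [InnerProductSpace ℂ H] (α : ℝ) : Set ℝ :=
  {r | ∃ T : H →L[ℂ] H, T ≠ 0 ∧ numericalRange T ⊆ sector α ∧ r = ‖T‖ / numericalRadius T}

/-- The optimal ratio `τ(α)`, for operators on `H`. -/
def tau (H : Type*) [NormedAddCommGroup H] [InnerProductSpace ℂ H] (α : ℝ) : ℝ :=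
  sSup (ratioSet H α)

/-- The orthogonal direct sum of two operators, on the Hilbert space direct sum `E ⊕ F`. -/
def opDirectSum {E F : Type*} [NormedAddCommGroup E] [InnerProductSpace ℂ E]
    [NormedAddCommGroup F] [InnerProductSpace ℂ F] (A : E →L[ℂ] E) (B : F →L[ℂ] F) :
    WithLp 2 (E × F) →L[ℂ] WithLp 2 (E × F) :=
  ((WithLp.prodContinuousLinearEquiv 2 ℂ E F).symm : E × F →L[ℂ] WithLp 2 (E × F)) ∘L
    (A.prodMap B) ∘L
    (WithLp.prodContinuousLinearEquiv 2 ℂ E F : WithLp 2 (E × F) →L[ℂ] E × F)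

/-- Unitary similarity of operators on possibly different Hilbert spaces: `U A = B U` for some
surjective linear isometry `U`. -/
def UnitarilySimilar {E F : Type*} [NormedAddCommGroup E] [InnerProductSpace ℂ E]
    [NormedAddCommGroup F] [InnerProductSpace ℂ F] (A : E →L[ℂ] E) (B : F →L[ℂ] F) : Prop :=
  ∃ U : E ≃ₗᵢ[ℂ] F, ∀ x : E, U (A x) = B (U x)

/-- The extremal two-by-two matrix, with `s = sin² α`. -/
def extremalMatrix (α : ℝ) : Matrix (Fin 2) (Fin 2) ℂ :=
  let s : ℝ := Real.sin α ^ 2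
  (1 / (1 + 2 * (s : ℂ))) •
    !![(Real.sqrt (1 + s - s ^ 2) : ℂ) + Complex.I * (Real.sqrt (s + s ^ 2) : ℂ), 2 * (s : ℂ);
       0, (Real.sqrt (1 + s - s ^ 2) : ℂ) - Complex.I * (Real.sqrt (s + s ^ 2) : ℂ)]

theorem mem_sector_iff_tan {α : ℝ} (h₀ : 0 < α) (h₁ : α < Real.pi / 2) (z : ℂ) :
    z ∈ sector α ↔ |z.im| ≤ z.re * Real.tan α := by
  have hc : 0 < Real.cos α := Real.cos_pos_of_mem_Ioo ⟨by linarith, h₁⟩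
  rw [Real.tan_eq_sin_div_cos, ← mul_div_assoc, le_div_iff₀ hc]
  rfl

theorem mem_sector_pi_div_two (z : ℂ) : z ∈ sector (Real.pi / 2) ↔ 0 ≤ z.re := by
  simp [sector]

theorem bddAbove_norm_numericalRange {H : Type*} [NormedAddCommGroup H] [InnerProductSpace ℂ H]
    (T : H →L[ℂ] H) : BddAbove ((fun z : ℂ => ‖z‖) '' numericalRange T) := by
  refine ⟨‖T‖, ?_⟩
  rintro _ ⟨_, ⟨x, hx, rfl⟩, rfl⟩
  calc ‖inner ℂ x (T x)‖ ≤ ‖x‖ * ‖T x‖ := norm_inner_le_norm _ _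
    _ ≤ ‖x‖ * (‖T‖ * ‖x‖) := by gcongr; exact T.le_opNorm x
    _ = ‖T‖ := by rw [hx]; ring

theorem norm_inner_le_numericalRadius {H : Type*} [NormedAddCommGroup H] [InnerProductSpace ℂ H]
    (T : H →L[ℂ] H) (x : H) : ‖inner ℂ x (T x)‖ ≤ numericalRadius T * ‖x‖ ^ 2 := by
  by_cases h : x = 0
  · simp [h]
  have hx : ‖x‖ ≠ 0 := norm_ne_zero_iff.mpr h
  have hu : ‖((‖x‖ : ℂ)⁻¹) • x‖ = 1 := by
    rw [norm_smul, norm_inv, Complex.norm_real, norm_norm, inv_mul_cancel₀ hx]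
  have := le_csSup (bddAbove_norm_numericalRange T) ⟨_, ⟨_, hu, rfl⟩, rfl⟩
  have e : ‖inner ℂ (((‖x‖ : ℂ)⁻¹) • x) (T (((‖x‖ : ℂ)⁻¹) • x))‖
      = ‖inner ℂ x (T x)‖ / ‖x‖ ^ 2 := by
    rw [map_smul, inner_smul_left, inner_smul_right, norm_mul, norm_mul, RCLike.norm_conj,
      norm_inv, Complex.norm_real, norm_norm]
    field_simp
  change ‖inner ℂ (((‖x‖ : ℂ)⁻¹) • x) (T (((‖x‖ : ℂ)⁻¹) • x))‖ ≤ numericalRadius T at this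
  rw [e, div_le_iff₀ (by positivity)] at this
  exact this

theorem norm_inner_map_le {H : Type*} [NormedAddCommGroup H] [InnerProductSpace ℂ H]
    (T : H →L[ℂ] H) (x y : H) (hx : ‖x‖ = 1) (hy : ‖y‖ ≤ 1) :
    ‖inner ℂ (T x) y‖ ≤ 4 * numericalRadius T := by
  have hw : 0 ≤ numericalRadius T := by
    refine Real.sSup_nonneg ?_
    rintro _ ⟨z, _, rfl⟩
    exact norm_nonneg z
  have hb : ∀ u : H, ‖u‖ ≤ 2 → ‖inner ℂ (T u) u‖ ≤ 4 * numericalRadius T := by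
    intro u hu
    rw [norm_inner_symm]
    refine (norm_inner_le_numericalRadius T u).trans ?_
    nlinarith [norm_nonneg u, mul_nonneg hw (sub_nonneg.mpr hu),
      mul_nonneg (mul_nonneg hw (sub_nonneg.mpr hu)) (norm_nonneg u)]
  have hIy : ‖Complex.I • y‖ ≤ 1 := by rw [norm_smul, Complex.norm_I, one_mul]; exact hy
  have h1 := hb (x + y) ((norm_add_le _ _).trans (by linarith))
  have h2 := hb (x - y) ((norm_sub_le _ _).trans (by linarith))
  have h3 := hb (x + Complex.I • y) ((norm_add_le _ _).trans (by linarith))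
  have h4 := hb (x - Complex.I • y) ((norm_sub_le _ _).trans (by linarith))
  have key := inner_map_polarization' (T : H →ₗ[ℂ] H) x y
  simp only [ContinuousLinearMap.coe_coe] at key
  rw [key, norm_div, Complex.norm_ofNat, div_le_iff₀ (by norm_num)]
  refine (norm_add_le _ _).trans ?_
  refine (add_le_add_left (norm_sub_le _ _) _).trans ?_
  refine (add_le_add_left (add_le_add_left (norm_sub_le _ _) _) _).trans ?_
  rw [norm_mul, norm_mul, Complex.norm_I, one_mul, one_mul]
  linarith

/-- The supremum that defines `tau` is taken over a set that is bounded above. -/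
theorem bddAbove_ratioSet (H : Type*) [NormedAddCommGroup H] [InnerProductSpace ℂ H] (α : ℝ) :
    BddAbove (ratioSet H α) := by
  refine ⟨4, ?_⟩
  rintro _ ⟨T, -, -, rfl⟩
  have hw : 0 ≤ numericalRadius T := by
    refine Real.sSup_nonneg ?_
    rintro _ ⟨z, _, rfl⟩
    exact norm_nonneg z
  refine div_le_of_le_mul₀ hw (by norm_num) ?_
  refine T.opNorm_le_bound (by positivity) fun x => ?_
  by_cases h : x = 0
  · simp [h]
  by_cases hTx : T x = 0
  · rw [hTx, norm_zero]; positivity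
  have hx : ‖x‖ ≠ 0 := norm_ne_zero_iff.mpr h
  have hT : ‖T x‖ ≠ 0 := norm_ne_zero_iff.mpr hTx
  have hu : ∀ v : H, ‖v‖ ≠ 0 → ‖((‖v‖ : ℂ)⁻¹) • v‖ = 1 := by
    intro v hv
    rw [norm_smul, norm_inv, Complex.norm_real, norm_norm, inv_mul_cancel₀ hv]
  have := norm_inner_map_le T _ _ (hu x hx) (hu (T x) hT).le
  rw [map_smul, inner_smul_left, inner_smul_right, inner_self_eq_norm_sq_to_K, norm_mul, norm_mul,
    RCLike.norm_conj, norm_inv, norm_inv, norm_pow] at this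
  simp only [Complex.norm_real, norm_norm, Complex.coe_algebraMap] at this
  have e : ‖x‖⁻¹ * (‖T x‖⁻¹ * ‖T x‖ ^ 2) = ‖T x‖ / ‖x‖ := by field_simp
  rw [e, div_le_iff₀ (by positivity)] at this
  exact this

end

/-! Part (a) is homogeneity of `w`. Part (b) never needs the value of `τ(α)`, only `τ(α) ≤ √(1 + s)`
(`tau_le`): since `w(T₁) ≤ 1/√(1 + s)`, both summands have numerical radius at most `1/τ(α)`, hence
so does `T/‖T‖`, and `‖T‖/w(T) ≥ τ(α)`. The opposite inequality is the definition of `τ`. The upper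
bound on `τ` is a certificate. Four Hermitian forms `m‖v‖² - Re(c⟨Tv, v⟩)` are nonnegative: two
because `|⟨Tv, v⟩| ≤ w(T)‖v‖²`, two because of the edges of the sector. `⟨Tx, y⟩` is a combination
of their off-diagonal values, weighted so that the diagonal terms in `Re⟨Tv, v⟩` cancel. -/

/-! ### Off-diagonal values of a nonnegative form -/

open ComplexConjugate in
-- The form `Q(v) = m‖v‖² - Re(c⟨Tv, v⟩)` is nonnegative and the left side is twice the modulus of
-- its polarization at `x, y`. Evaluating `Q` at `x - ūy`, with the phase `u` making that
-- polarization real and nonnegative, gives the bound.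
theorem norm_inner_hermitianForm_le {H : Type*} [NormedAddCommGroup H] [InnerProductSpace ℂ H]
    (T : H →L[ℂ] H) (c : ℂ) (m : ℝ) (h : ∀ x : H, (c * inner ℂ x (T x)).re ≤ m * ‖x‖ ^ 2)
    (x y : H) :
    ‖2 * m * inner ℂ y x - c * inner ℂ y (T x) - conj c * inner ℂ (T y) x‖ ≤
      m * (‖x‖ ^ 2 + ‖y‖ ^ 2) - (c * inner ℂ x (T x)).re - (c * inner ℂ y (T y)).re := by
  set z : ℂ := 2 * m * inner ℂ y x - c * inner ℂ y (T x) - conj c * inner ℂ (T y) x with hz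
  obtain ⟨u, hu, huz⟩ : ∃ u : ℂ, ‖u‖ = 1 ∧ u * z = (‖z‖ : ℂ) := by
    by_cases h0 : z = 0
    · exact ⟨1, by simp, by simp [h0]⟩
    · have hn : ‖z‖ ≠ 0 := norm_ne_zero_iff.mpr h0
      refine ⟨conj z / ‖z‖, ?_, ?_⟩
      · rw [norm_div, RCLike.norm_conj, Complex.norm_real, norm_norm, div_self hn]
      · have hn' : (‖z‖ : ℂ) ≠ 0 := by exact_mod_cast hn
        rw [div_mul_eq_mul_div, mul_comm, Complex.mul_conj, Complex.normSq_eq_norm_sq,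
          div_eq_iff hn']
        push_cast; ring
  have huu : conj u * u = 1 := by
    rw [mul_comm, Complex.mul_conj, Complex.normSq_eq_norm_sq, hu]; norm_num
  have key := h (x - conj u • y)
  have hsq : ‖x - conj u • y‖ ^ 2 = ‖x‖ ^ 2 + ‖y‖ ^ 2 - 2 * (u * inner ℂ y x).re := by
    rw [norm_sub_sq (𝕜 := ℂ), norm_smul, RCLike.norm_conj, hu, one_mul, inner_smul_right,
      ← inner_conj_symm x y, ← map_mul]
    simp only [RCLike.re_to_complex, Complex.conj_re]
    ring
  have hT : inner ℂ (x - conj u • y) (T (x - conj u • y)) =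
      inner ℂ x (T x) + inner ℂ y (T y) - u * inner ℂ y (T x) - conj u * inner ℂ x (T y) := by
    simp only [map_sub, map_smul, inner_sub_left, inner_sub_right, inner_smul_left,
      inner_smul_right, Complex.conj_conj]
    linear_combination (inner ℂ y (T y)) * huu
  have hc : (c * (conj u * inner ℂ x (T y))).re = (u * (conj c * inner ℂ (T y) x)).re := by
    rw [← Complex.conj_re, map_mul, map_mul, inner_conj_symm, Complex.conj_conj]
    congr 1; ring
  have hre : ‖z‖ = 2 * m * (u * inner ℂ y x).re - (c * (u * inner ℂ y (T x))).re
      - (c * (conj u * inner ℂ x (T y))).re := by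
    rw [hc]
    have e : u * z = ((2 * m : ℝ) : ℂ) * (u * inner ℂ y x) - c * (u * inner ℂ y (T x))
        - u * (conj c * inner ℂ (T y) x) := by rw [hz]; push_cast; ring
    have := congrArg Complex.re (huz.symm.trans e)
    rwa [Complex.sub_re, Complex.sub_re, Complex.re_ofReal_mul, Complex.ofReal_re] at this
  rw [hsq, hT, mul_sub, mul_sub, mul_add, Complex.sub_re, Complex.sub_re, Complex.add_re] at key
  rw [hre]
  linarith

/-! ### Numerical radius and sector: scaling -/

theorem numericalRadius_nonneg {H : Type*} [NormedAddCommGroup H] [InnerProductSpace ℂ H]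
    (T : H →L[ℂ] H) : 0 ≤ numericalRadius T := by
  refine Real.sSup_nonneg ?_
  rintro _ ⟨z, _, rfl⟩
  exact norm_nonneg z

theorem numericalRadius_le {H : Type*} [NormedAddCommGroup H] [InnerProductSpace ℂ H]
    {T : H →L[ℂ] H} {m : ℝ} (hm : 0 ≤ m) (h : ∀ x : H, ‖x‖ = 1 → ‖inner ℂ x (T x)‖ ≤ m) :
    numericalRadius T ≤ m := by
  refine Real.sSup_le ?_ hm
  rintro _ ⟨_, ⟨x, hx, rfl⟩, rfl⟩
  exact h x hx

theorem numericalRadius_smul {H : Type*} [NormedAddCommGroup H] [InnerProductSpace ℂ H]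
    (c : ℂ) (T : H →L[ℂ] H) : numericalRadius (c • T) = ‖c‖ * numericalRadius T := by
  have hle : ∀ (d : ℂ) (S : H →L[ℂ] H), numericalRadius (d • S) ≤ ‖d‖ * numericalRadius S := by
    intro d S
    refine numericalRadius_le (mul_nonneg (norm_nonneg _) (numericalRadius_nonneg S)) fun x hx => ?_
    rw [smul_apply, inner_smul_right, norm_mul]
    have := norm_inner_le_numericalRadius S x
    rw [hx] at this
    gcongr
    linarith
  refine le_antisymm (hle c T) ?_
  by_cases hc : c = 0
  · simpa [hc] using numericalRadius_nonneg ((0 : ℂ) • T)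
  have := hle c⁻¹ (c • T)
  rw [smul_smul, inv_mul_cancel₀ hc, one_smul, norm_inv] at this
  have hn : 0 < ‖c‖ := norm_pos_iff.mpr hc
  rwa [inv_mul_eq_div, le_div_iff₀ hn, mul_comm] at this

/-- The quadratic form of an operator with numerical range in the sector lies in the sector. -/
theorem inner_mem_sector {H : Type*} [NormedAddCommGroup H] [InnerProductSpace ℂ H]
    {T : H →L[ℂ] H} {α : ℝ} (hW : numericalRange T ⊆ sector α) (x : H) :
    inner ℂ x (T x) ∈ sector α := by
  by_cases h : x = 0
  · simp [h, sector]
  have hx : ‖x‖ ≠ 0 := norm_ne_zero_iff.mpr h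
  have hu : ‖((‖x‖ : ℂ)⁻¹) • x‖ = 1 := by
    rw [norm_smul, norm_inv, Complex.norm_real, norm_norm, inv_mul_cancel₀ hx]
  have h1 := hW ⟨_, hu, rfl⟩
  have e : inner ℂ x (T x) = ((‖x‖ ^ 2 : ℝ) : ℂ) *
      inner ℂ (((‖x‖ : ℂ)⁻¹) • x) (T (((‖x‖ : ℂ)⁻¹) • x)) := by
    have hx' : (‖x‖ : ℂ) ≠ 0 := by exact_mod_cast hx
    rw [map_smul, inner_smul_left, inner_smul_right, map_inv₀, Complex.conj_ofReal]
    push_cast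
    field_simp
  rw [e]
  simp only [sector, Set.mem_ofPred_eq] at h1 ⊢
  rw [Complex.im_ofReal_mul, Complex.re_ofReal_mul, abs_mul, abs_of_nonneg (sq_nonneg ‖x‖),
    mul_assoc, mul_assoc]
  exact mul_le_mul_of_nonneg_left h1 (sq_nonneg _)

/-! ### Norm against numerical radius in a sector -/

/-- The sharp bound of the norm by the numerical radius, for sectorial operators. -/
theorem norm_le_sqrt_mul_numericalRadius {H : Type*} [NormedAddCommGroup H]
    [InnerProductSpace ℂ H] {α : ℝ} (h₀ : 0 < α) (h₁ : α ≤ Real.pi / 2)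
    {T : H →L[ℂ] H} (hW : numericalRange T ⊆ sector α) :
    ‖T‖ ≤ Real.sqrt (1 + Real.sin α ^ 2) * numericalRadius T := by
  set p := Real.sin α with hp
  set q := Real.cos α with hq
  have hpq : p ^ 2 + q ^ 2 = 1 := Real.sin_sq_add_cos_sq α
  have hp0 : 0 < p := Real.sin_pos_of_pos_of_lt_pi h₀ (by linarith [Real.pi_pos])
  have hp1 : p ≤ 1 := Real.sin_le_one α
  -- Since `k² = 1 + p²q²`, the numbers `k ± ip²` have modulus `t` and `1/(4p) ± iq/4` have modulus
  -- `k/(4p)`.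
  set k := Real.sqrt (1 + p ^ 2 - p ^ 4) with hk
  have hk2 : k ^ 2 = 1 + p ^ 2 - p ^ 4 := Real.sq_sqrt (by nlinarith [sq_nonneg p])
  set t := Real.sqrt (1 + p ^ 2) with ht
  set w := numericalRadius T with hw
  have hw0 : 0 ≤ w := numericalRadius_nonneg T
  have ht0 : 0 ≤ t := Real.sqrt_nonneg _
  have hform : ∀ x y : H, ‖(inner ℂ y (T x) : ℂ)‖ ≤ t * w / 2 * (‖x‖ ^ 2 + ‖y‖ ^ 2) := by
    intro x y
    have sup (e : ℝ) (he : e ^ 2 = 1) (v : H) :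
        ((⟨k, e * p ^ 2⟩ : ℂ) * inner ℂ v (T v)).re ≤ (t * w) * ‖v‖ ^ 2 := by
      refine (Complex.re_le_norm _).trans ?_
      rw [norm_mul, mul_assoc]
      have : ‖(⟨k, e * p ^ 2⟩ : ℂ)‖ = t := by
        rw [Complex.norm_def, Complex.normSq_mk, ht]
        congr 1
        linear_combination hk2 + p ^ 4 * he
      rw [this]
      exact mul_le_mul_of_nonneg_left (norm_inner_le_numericalRadius T v) ht0
    -- The two edges of the sector as half-plane conditions, hence `m = 0`.
    have side (e : ℝ) (he : e = 1 ∨ e = -1) (v : H) :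
        ((⟨-p, e * q⟩ : ℂ) * inner ℂ v (T v)).re ≤ (0 : ℝ) * ‖v‖ ^ 2 := by
      have h1 : |(inner ℂ v (T v)).im| * q ≤ (inner ℂ v (T v)).re * p := inner_mem_sector hW v
      have hq0 : 0 ≤ q := Real.cos_nonneg_of_mem_Icc ⟨by linarith [Real.pi_pos], h₁⟩
      rw [Complex.mul_re]
      have := mul_le_mul_of_nonneg_right (neg_abs_le (inner ℂ v (T v)).im) hq0
      have := mul_le_mul_of_nonneg_right (le_abs_self (inner ℂ v (T v)).im) hq0
      rcases he with rfl | rfl <;> simp only [] <;> linarith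
    have a1 := norm_inner_hermitianForm_le T _ _ (sup 1 (by norm_num)) x y
    have a2 := norm_inner_hermitianForm_le T _ _ (sup (-1) (by norm_num)) x y
    have b1 := norm_inner_hermitianForm_le T _ _ (side 1 (Or.inl rfl)) x y
    have b2 := norm_inner_hermitianForm_le T _ _ (side (-1) (Or.inr rfl)) x y
    set a : ℂ := inner ℂ y (T x)
    set b : ℂ := inner ℂ (T y) x
    set d : ℂ := inner ℂ y x
    set u : ℂ := inner ℂ x (T x)
    set v : ℂ := inner ℂ y (T y)
    have mkeq (r i : ℝ) : (⟨r, i⟩ : ℂ) = r + i * Complex.I := Complex.mk_eq_add_mul_I r i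
    set Zp := 2 * ((t * w : ℝ) : ℂ) * d - (⟨k, 1 * p ^ 2⟩ : ℂ) * a
      - (starRingEnd ℂ) (⟨k, 1 * p ^ 2⟩ : ℂ) * b with hZp
    set Zm := 2 * ((t * w : ℝ) : ℂ) * d - (⟨k, -1 * p ^ 2⟩ : ℂ) * a
      - (starRingEnd ℂ) (⟨k, -1 * p ^ 2⟩ : ℂ) * b with hZm
    set Wp := 2 * ((0 : ℝ) : ℂ) * d - (⟨-p, 1 * q⟩ : ℂ) * a
      - (starRingEnd ℂ) (⟨-p, 1 * q⟩ : ℂ) * b with hWp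
    set Wm := 2 * ((0 : ℝ) : ℂ) * d - (⟨-p, -1 * q⟩ : ℂ) * a
      - (starRingEnd ℂ) (⟨-p, -1 * q⟩ : ℂ) * b with hWm
    have hp0' : (p : ℂ) ≠ 0 := by exact_mod_cast hp0.ne'
    have hpq' : (p : ℂ) ^ 2 + (q : ℂ) ^ 2 = 1 := by exact_mod_cast hpq
    -- The weights eliminate both `d` and `b`, leaving `a` alone.
    have ha : a = (⟨1 / (4 * p), q / 4⟩ : ℂ) * Wp + (⟨1 / (4 * p), -(q / 4)⟩ : ℂ) * Wm
        + (⟨0, 1 / 4⟩ : ℂ) * (Zp - Zm) := by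
      rw [hZp, hZm, hWp, hWm]
      simp only [mkeq, map_add, map_mul, Complex.conj_ofReal, Complex.conj_I]
      push_cast
      field_simp
      linear_combination (-2 * p * (a - b)) * hpq' +
        (2 * p * (a - b) * ((p : ℂ) ^ 2 + (q : ℂ) ^ 2)) * Complex.I_sq
    have hc (e : ℝ) (he : e ^ 2 = (q / 4) ^ 2) : ‖(⟨1 / (4 * p), e⟩ : ℂ)‖ = k / (4 * p) := by
      rw [Complex.norm_def, Complex.normSq_mk,
        Real.sqrt_eq_iff_mul_self_eq (by nlinarith [sq_nonneg e, sq_nonneg (1 / (4 * p))])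
          (div_nonneg (Real.sqrt_nonneg _) (by positivity)), ← pow_two e, he]
      field_simp
      linear_combination p ^ 2 * hpq - hk2
    have h4 : ‖(⟨0, 1 / 4⟩ : ℂ)‖ = 1 / 4 := by
      rw [mkeq]; simp
    have hk0 : 0 ≤ k / (4 * p) := div_nonneg (Real.sqrt_nonneg _) (by positivity)
    have hna : ‖a‖ ≤ k / (4 * p) * (‖Wp‖ + ‖Wm‖) + 1 / 4 * (‖Zp‖ + ‖Zm‖) := by
      rw [ha]
      refine (norm_add₃_le).trans ?_
      rw [norm_mul, norm_mul, norm_mul, hc _ rfl, hc _ (by ring), h4, mul_add]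
      gcongr
      exact norm_sub_le _ _
    simp only [Complex.mul_re] at a1 a2 b1 b2
    have hWs : ‖Wp‖ + ‖Wm‖ ≤ 2 * p * (u.re + v.re) := by linarith
    -- This `Re(u + v)` term cancels exactly the one contributed by `Zp` and `Zm`.
    have hkp : k / (4 * p) * (2 * p * (u.re + v.re)) = k / 2 * (u.re + v.re) := by
      field_simp; norm_num
    have := mul_le_mul_of_nonneg_left hWs hk0
    rw [hkp] at this
    linarith
  refine T.opNorm_le_bound (mul_nonneg ht0 hw0) fun x => ?_
  by_cases h : x = 0
  · simp [h]
  by_cases hTx : T x = 0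
  · rw [hTx, norm_zero]; positivity
  have hx : 0 < ‖x‖ := norm_pos_iff.mpr h
  have hT : 0 < ‖T x‖ := norm_pos_iff.mpr hTx
  -- Rescaling `T x` to the norm of `x` makes the arithmetic-mean bound a product bound.
  have := hform x (((‖x‖ / ‖T x‖ : ℝ) : ℂ) • T x)
  rw [inner_smul_left, norm_mul, RCLike.norm_conj, norm_smul, Complex.norm_real,
    Real.norm_of_nonneg (by positivity), inner_self_eq_norm_sq_to_K, norm_pow] at this
  simp only [Complex.coe_algebraMap, Complex.norm_real, norm_norm] at this
  have e1 : ‖x‖ / ‖T x‖ * ‖T x‖ ^ 2 = ‖x‖ * ‖T x‖ := by field_simp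
  have e2 : ‖x‖ / ‖T x‖ * ‖T x‖ = ‖x‖ := by field_simp
  rw [e1, e2] at this
  refine le_of_mul_le_mul_left (this.trans_eq ?_) hx
  ring

/-! ### Numerical radius of the extremal matrix -/

theorem norm_inner_extremalMatrix_le (α : ℝ) (x : EuclideanSpace ℂ (Fin 2)) :
    ‖inner ℂ x (Matrix.toEuclideanCLM (n := Fin 2) (𝕜 := ℂ) (extremalMatrix α) x)‖ ≤
      1 / Real.sqrt (1 + Real.sin α ^ 2) * ‖x‖ ^ 2 := by
  set s := Real.sin α ^ 2 with hs
  have hs0 : 0 ≤ s := sq_nonneg _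
  have hs1 : s ≤ 1 := Real.sin_sq_le_one α
  set k := Real.sqrt (1 + s - s ^ 2) with hk
  have hk2 : k ^ 2 = 1 + s - s ^ 2 := Real.sq_sqrt (by nlinarith)
  set σ := Real.sqrt (s + s ^ 2) with hσ
  have hσ2 : σ ^ 2 = s + s ^ 2 := Real.sq_sqrt (by positivity)
  set t := Real.sqrt (1 + s) with ht
  have ht2 : t ^ 2 = 1 + s := Real.sq_sqrt (by positivity)
  have ht0 : 0 < t := Real.sqrt_pos.mpr (by positivity)
  obtain ⟨a, ha⟩ : ∃ a, a = x 0 := ⟨_, rfl⟩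
  obtain ⟨b, hb⟩ : ∃ b, b = x 1 := ⟨_, rfl⟩
  have hinner : inner ℂ x (Matrix.toEuclideanCLM (n := Fin 2) (𝕜 := ℂ) (extremalMatrix α) x) =
      ((1 / (1 + 2 * s) : ℝ) : ℂ) *
        ((k + Complex.I * σ) * (starRingEnd ℂ a * a) + (k - Complex.I * σ) * (starRingEnd ℂ b * b)
          + 2 * s * (starRingEnd ℂ a * b)) := by
    rw [PiLp.inner_apply, Fin.sum_univ_two]
    simp only [Matrix.ofLp_toEuclideanCLM, extremalMatrix, ← hs, ← hk, ← hσ, ← ha, ← hb,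
      Matrix.mulVec, dotProduct, Fin.sum_univ_two, Matrix.smul_apply, Matrix.of_apply,
      Matrix.cons_val', Matrix.cons_val_zero, Matrix.cons_val_one, Matrix.cons_val_fin_one,
      smul_eq_mul, RCLike.inner_apply]
    push_cast
    ring
  have hnorm : ‖x‖ ^ 2 = (a.re ^ 2 + a.im ^ 2) + (b.re ^ 2 + b.im ^ 2) := by
    rw [EuclideanSpace.norm_sq_eq, Fin.sum_univ_two, ← ha, ← hb, Complex.sq_norm, Complex.sq_norm,
      Complex.normSq_apply, Complex.normSq_apply]
    ring
  rw [hinner, norm_mul, Complex.norm_real, Real.norm_of_nonneg (by positivity), hnorm]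
  obtain ⟨n, hn⟩ : ∃ n, n = (a.re ^ 2 + a.im ^ 2) + (b.re ^ 2 + b.im ^ 2) := ⟨_, rfl⟩
  -- Bloch coordinates: `(d, R, J)` lies on the sphere of radius `n = ‖x‖²`, and the quadratic form
  -- is affine in them.
  obtain ⟨d, hd⟩ : ∃ d, d = (a.re ^ 2 + a.im ^ 2) - (b.re ^ 2 + b.im ^ 2) := ⟨_, rfl⟩
  obtain ⟨R, hR⟩ : ∃ R, R = 2 * (a.re * b.re + a.im * b.im) := ⟨_, rfl⟩
  obtain ⟨J, hJ⟩ : ∃ J, J = 2 * (a.re * b.im - a.im * b.re) := ⟨_, rfl⟩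
  have hsum : d ^ 2 + R ^ 2 + J ^ 2 = n ^ 2 := by rw [hn, hd, hR, hJ]; ring
  have hz : (k + Complex.I * σ) * (starRingEnd ℂ a * a) + (k - Complex.I * σ) * (starRingEnd ℂ b * b)
      + 2 * s * (starRingEnd ℂ a * b) = ⟨k * n + s * R, σ * d + s * J⟩ := by
    rw [hn, hd, hR, hJ]
    apply Complex.ext <;> simp <;> ring
  have hn0 : 0 ≤ n := by rw [hn]; positivity
  have hmain : (k * n + s * R) ^ 2 + (σ * d + s * J) ^ 2 ≤ ((1 + 2 * s) / t * n) ^ 2 := by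
    -- Cauchy–Schwarz in `(d, J)`, with `σ² + s² = s + 2s²`.
    have h1 : (σ * d + s * J) ^ 2 ≤ (s + 2 * s ^ 2) * (n ^ 2 - R ^ 2) := by
      have : (s + 2 * s ^ 2) * (n ^ 2 - R ^ 2) = (σ * d + s * J) ^ 2 + (σ * J - s * d) ^ 2 := by
        rw [← hsum]
        linear_combination -(d ^ 2 + J ^ 2) * hσ2
      rw [this]
      linarith [sq_nonneg (σ * J - s * d)]
    -- What remains is quadratic in `R`; completing the square isolates its maximum, at `R = kn/(1 +
    -- s)`.
    have h2 : ((1 + 2 * s) / t * n) ^ 2 = (k * n + s * R) ^ 2 + (s + 2 * s ^ 2) * (n ^ 2 - R ^ 2)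
        + (s + s ^ 2) * (R - k * n / (1 + s)) ^ 2 := by
      rw [mul_pow, div_pow, ht2]
      have : 1 + s ≠ 0 := by positivity
      field_simp
      linear_combination (-(1 + 2 * s) * n ^ 2) * hk2
    have h3 : 0 ≤ (s + s ^ 2) * (R - k * n / (1 + s)) ^ 2 := by positivity
    linarith
  rw [hz, ← hn, Complex.norm_def, Complex.normSq_mk, ← pow_two, ← pow_two]
  have hsq := Real.sqrt_le_sqrt hmain
  rw [Real.sqrt_sq (by positivity)] at hsq
  refine (mul_le_mul_of_nonneg_left hsq (by positivity)).trans_eq ?_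
  field_simp

/-! ### Direct sums and the conclusion -/

theorem norm_inner_opDirectSum_le {E F : Type*} [NormedAddCommGroup E] [InnerProductSpace ℂ E]
    [NormedAddCommGroup F] [InnerProductSpace ℂ F] {A : E →L[ℂ] E} {B : F →L[ℂ] F} {m : ℝ}
    (hA : ∀ x, ‖inner ℂ x (A x)‖ ≤ m * ‖x‖ ^ 2) (hB : ∀ x, ‖inner ℂ x (B x)‖ ≤ m * ‖x‖ ^ 2)
    (x : WithLp 2 (E × F)) : ‖inner ℂ x (opDirectSum A B x)‖ ≤ m * ‖x‖ ^ 2 := by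
  rw [WithLp.prod_norm_sq_eq_of_L2, mul_add, WithLp.prod_inner_apply]
  exact (norm_add_le _ _).trans (add_le_add (hA _) (hB _))

theorem tau_le {H : Type*} [NormedAddCommGroup H] [InnerProductSpace ℂ H]
    {α : ℝ} (h₀ : 0 < α) (h₁ : α ≤ Real.pi / 2) : tau H α ≤ Real.sqrt (1 + Real.sin α ^ 2) := by
  refine Real.sSup_le ?_ (Real.sqrt_nonneg _)
  rintro _ ⟨T, -, hW, rfl⟩
  exact div_le_of_le_mul₀ (numericalRadius_nonneg T) (Real.sqrt_nonneg _)
    (norm_le_sqrt_mul_numericalRadius h₀ h₁ hW)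

theorem theorem3p1 {H : Type*} [NormedAddCommGroup H] [InnerProductSpace ℂ H] [CompleteSpace H]
    (α : ℝ) (hα₀ : 0 < α) (hα₁ : α ≤ Real.pi / 2)
    (T : H →L[ℂ] H) (hT : T ≠ 0) (hW : numericalRange T ⊆ sector α) :
    (‖T‖ / numericalRadius T = tau H α ↔
      numericalRadius (((‖T‖ : ℂ)⁻¹) • T) = 1 / tau H α) ∧
    (∀ (K : Type*) [NormedAddCommGroup K] [InnerProductSpace ℂ K] [CompleteSpace K]
      (T₂ : K →L[ℂ] K),
      UnitarilySimilar (((‖T‖ : ℂ)⁻¹) • T)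
        (opDirectSum (Matrix.toEuclideanCLM (n := Fin 2) (𝕜 := ℂ) (extremalMatrix α)) T₂) →
      numericalRadius T₂ ≤ 1 / tau H α →
      ‖T‖ / numericalRadius T = tau H α) := by
  have hn : 0 < ‖T‖ := norm_pos_iff.mpr hT
  have hscale : numericalRadius (((‖T‖ : ℂ)⁻¹) • T) = (‖T‖ / numericalRadius T)⁻¹ := by
    rw [numericalRadius_smul, norm_inv, Complex.norm_real, norm_norm, inv_div, inv_mul_eq_div]
  -- Inversion on `ℝ` is injective even at `0`, so (a) needs no positivity.
  refine ⟨by rw [hscale, one_div, inv_inj], fun K _ _ _ T₂ hU hT₂ => ?_⟩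
  have hw : 0 < numericalRadius T := by
    refine (numericalRadius_nonneg T).lt_of_ne fun h => ?_
    have := norm_le_sqrt_mul_numericalRadius hα₀ hα₁ hW
    rw [← h, mul_zero] at this
    linarith
  have hle : ‖T‖ / numericalRadius T ≤ tau H α := le_csSup (bddAbove_ratioSet H α) ⟨T, hT, hW, rfl⟩
  have hpos : 0 < tau H α := (div_pos hn hw).trans_le hle
  refine le_antisymm hle ?_
  have hbound : numericalRadius (((‖T‖ : ℂ)⁻¹) • T) ≤ 1 / tau H α := by
    refine numericalRadius_le (by positivity) fun x hx => ?_
    obtain ⟨U, hU⟩ := hU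
    rw [← U.inner_map_map, hU]
    have := norm_inner_opDirectSum_le (m := 1 / tau H α)
      (fun v => (norm_inner_extremalMatrix_le α v).trans
        (mul_le_mul_of_nonneg_right (one_div_le_one_div_of_le hpos (tau_le hα₀ hα₁))
          (sq_nonneg _)))
      (fun v => (norm_inner_le_numericalRadius T₂ v).trans
        (mul_le_mul_of_nonneg_right hT₂ (sq_nonneg _))) (U x)
    rwa [U.norm_map, hx, one_pow, mul_one] at this
  rwa [hscale, one_div, inv_le_inv₀ (div_pos hn hw) hpos] at hbound
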